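/- Let $A_1,\dots,A_m\in\mathbb R^{n\times n}$ and $a_1,\dots,a_m\in\mathbb R^n$, and let $f=(f_1,\dots,f_m):\mathbb R^n\to\mathbb R^m$ be the quadratic map $$f_i(x)=\tfrac12\,x^TA_ix+a_i^Tx,\qquad i=1,\dots,m.$$ Let $\|x\|=\sqrt{x^Tx}$ for vectors, let $\|A_i\|$ denote the spectral norm of $A_i$, and let $\lambda_{\max}$, $\lambda_{\min}$ denote the largest and smallest eigenvalue of a symmetric matrix. Let $A=[a_1\ \cdots\ a_m]\in\mathbb R^{n\times m}$ and $$L=\sqrt{\sum_{i=1}^m\|A_i\|^2},\qquad L_{\rm new}=\sqrt{\lambda_{\max}\Big(\sum_{i=1}^mA_i^TA_i\Big)},\qquad \nu=\sigma_{\min}(A)=\sqrt{\lambda_{\min}(A^TA)}.$$ Then $L_{\rm new}\le L$. Moreover, for every real $\varepsilon<\nu/(2L_{\rm new})$ (where the right-hand side is read as $+\infty$ if $L_{\rm new}=0$), the image $$F_m(\varepsilon)=\{f(x): x\in\mathbb R^n,\ \|x\|\le\varepsilon\}$$ is a convex subset of $\mathbb R^m$. -/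

import Mathlib

noncomputable section

namespace QuadraticImage

open scoped Matrix

/-- The largest real eigenvalue of a square real matrix (used for symmetric matrices only). -/
def lambdaMax {k : ℕ} (M : Matrix (Fin k) (Fin k) ℝ) : ℝ :=
  sSup (spectrum ℝ M)

/-- The smallest real eigenvalue of a square real matrix (used for symmetric matrices only). -/
def lambdaMin {k : ℕ} (M : Matrix (Fin k) (Fin k) ℝ) : ℝ :=
  sInf (spectrum ℝ M)

/-- The quadratic map `f = (f₁, …, f_m)` with `f_i(x) = ½ xᵀ A_i x + a_iᵀ x`. -/
def quadMap {n m : ℕ} (A : Fin m → Matrix (Fin n) (Fin n) ℝ)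
    (a : Fin m → EuclideanSpace ℝ (Fin n)) (x : EuclideanSpace ℝ (Fin n)) :
    EuclideanSpace ℝ (Fin m) :=
  WithLp.toLp 2 fun i => (1 / 2 : ℝ) * (x.ofLp ⬝ᵥ (A i *ᵥ x.ofLp)) + (a i).ofLp ⬝ᵥ x.ofLp

/-- The image `F_m(ε)` of the closed Euclidean ball of radius `ε` about the origin. -/
def ballImage {n m : ℕ} (A : Fin m → Matrix (Fin n) (Fin n) ℝ)
    (a : Fin m → EuclideanSpace ℝ (Fin n)) (ε : ℝ) : Set (EuclideanSpace ℝ (Fin m)) :=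
  {y | ∃ x : EuclideanSpace ℝ (Fin n), ‖x‖ ≤ ε ∧ quadMap A a x = y}

/-- The `n × m` matrix `[a₁ … a_m]` with columns `a_i`. -/
def colMatrix {n m : ℕ} (a : Fin m → EuclideanSpace ℝ (Fin n)) : Matrix (Fin n) (Fin m) ℝ :=
  Matrix.of fun j i => a i j

/-- `ν = σ_min([a₁ … a_m])`, the square root of the smallest eigenvalue of the
`m × m` Gram matrix (so `ν = 0` when `m > n`). -/
def nu {n m : ℕ} (a : Fin m → EuclideanSpace ℝ (Fin n)) : ℝ :=
  Real.sqrt (lambdaMin ((colMatrix a)ᵀ * colMatrix a))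

open scoped Matrix.Norms.L2Operator in
/-- `L = √(∑ ‖A_i‖²)`, where `‖·‖` is the spectral norm. -/
def L {n m : ℕ} (A : Fin m → Matrix (Fin n) (Fin n) ℝ) : ℝ :=
  Real.sqrt (∑ i, ‖A i‖ ^ 2)

/-- `L_new = √(λ_max(∑ A_iᵀ A_i))`. -/
def Lnew {n m : ℕ} (A : Fin m → Matrix (Fin n) (Fin n) ℝ) : ℝ :=
  Real.sqrt (lambdaMax (∑ i, (A i)ᵀ * A i))

end QuadraticImage

end

/-! Write the map as `f x = ½ B(x, x) + T x` with `B` symmetric. At `x₀ = s x₁ + t x₂` the convex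
combination of values misses `f x₀` by only `(st/2) B(x₁ - x₂, x₁ - x₂)`. The ball is strongly
convex, so `x₀` lies at distance at least `ρ` from the sphere, with `ρ` also of order `st ‖x₁ -
x₂‖²`. The defect is absorbed by solving `f (x₀ + w) = f x₀ + defect` with `‖w‖ ≤ ρ`: the derivative
`T + B x₀` stays onto because `2Λε < ν`, and a contraction built from its right inverse gives `w`.
The constant `L_new` bounds `B` because `∑ ‖A_i x‖²` is a single Rayleigh quotient, of `∑ A_iᵀ A_i`.
-/

/-- A linear map whose adjoint is bounded below by `μ > 0` has a linear right inverse of norm at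
most `μ⁻¹`. -/
theorem LinearMap.exists_rightInverse_of_adjoint_bound {E F : Type*}
    [NormedAddCommGroup E] [InnerProductSpace ℝ E] [FiniteDimensional ℝ E]
    [NormedAddCommGroup F] [InnerProductSpace ℝ F] [FiniteDimensional ℝ F]
    (D : E →ₗ[ℝ] F) {μ : ℝ} (hμ : 0 < μ)
    (hD : ∀ c, μ * ‖c‖ ≤ ‖LinearMap.adjoint D c‖) :
    ∃ R : F →ₗ[ℝ] E, (∀ v, D (R v) = v) ∧ ∀ v, μ * ‖R v‖ ≤ ‖v‖ := by
  have hsq : ∀ c, ‖LinearMap.adjoint D c‖ ^ 2 = inner ℝ c (D (LinearMap.adjoint D c)) := by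
    intro c
    rw [← LinearMap.adjoint_inner_left, real_inner_self_eq_norm_sq]
  have hinj : Function.Injective (D ∘ₗ LinearMap.adjoint D) := by
    rw [injective_iff_map_eq_zero]
    intro c hc
    have h1 := hsq c
    rw [LinearMap.comp_apply] at hc
    rw [hc, inner_zero_right] at h1
    have h2 : ‖LinearMap.adjoint D c‖ = 0 := by simpa using h1
    have h3 := hD c
    rw [h2] at h3
    have h4 : ‖c‖ ≤ 0 := by
      by_contra! h
      linarith [mul_pos hμ h]
    exact norm_le_zero_iff.mp h4
  -- The right inverse is `D* (D D*)⁻¹`.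
  let e := LinearEquiv.ofInjectiveEndo (D ∘ₗ LinearMap.adjoint D) hinj
  have he : ∀ v, D (LinearMap.adjoint D (e.symm v)) = v := fun v => e.apply_symm_apply v
  refine ⟨LinearMap.adjoint D ∘ₗ e.symm.toLinearMap, he, fun v => ?_⟩
  have h1 := hsq (e.symm v)
  rw [he] at h1
  have h2 := real_inner_le_norm (e.symm v) v
  have h3 := hD (e.symm v)
  change μ * ‖LinearMap.adjoint D (e.symm v)‖ ≤ ‖v‖
  set r := ‖LinearMap.adjoint D (e.symm v)‖ with hr
  rcases (norm_nonneg (LinearMap.adjoint D (e.symm v))).eq_or_lt with h0 | h0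
  · rw [hr, ← h0, mul_zero]
    exact norm_nonneg v
  · refine le_of_mul_le_mul_right ?_ h0
    calc μ * r * r = μ * r ^ 2 := by ring
      _ ≤ μ * (‖e.symm v‖ * ‖v‖) := by gcongr; linarith
      _ = (μ * ‖e.symm v‖) * ‖v‖ := by ring
      _ ≤ r * ‖v‖ := by gcongr
      _ = ‖v‖ * r := mul_comm _ _

/-- For a symmetric bilinear map, a bound on the diagonal bounds the whole map. -/
theorem LinearMap.norm_le_of_symm_of_diag_bound {E F : Type*}
    [NormedAddCommGroup E] [InnerProductSpace ℝ E] [NormedAddCommGroup F] [InnerProductSpace ℝ F]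
    (B : E →ₗ[ℝ] E →ₗ[ℝ] F) {Λ : ℝ} (hB : ∀ x y, B x y = B y x)
    (hdiag : ∀ x, ‖B x x‖ ≤ Λ * ‖x‖ ^ 2) (x y : E) :
    ‖B x y‖ ≤ Λ * ‖x‖ * ‖y‖ := by
  have key : ∀ u v : E, ‖B u v‖ ≤ Λ * (‖u‖ ^ 2 + ‖v‖ ^ 2) / 2 := by
    intro u v
    have h1 : (4 : ℝ) • B u v = B (u + v) (u + v) - B (u - v) (u - v) := by
      simp only [map_add, map_sub, LinearMap.add_apply, LinearMap.sub_apply, hB v u]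
      module
    have h2 : ‖(4 : ℝ) • B u v‖ ≤ Λ * ‖u + v‖ ^ 2 + Λ * ‖u - v‖ ^ 2 := by
      rw [h1]
      exact (norm_sub_le _ _).trans (add_le_add (hdiag _) (hdiag _))
    rw [norm_smul] at h2
    norm_num at h2
    have h3 := parallelogram_law_with_norm ℝ u v
    have h4 : Λ * ‖u + v‖ ^ 2 + Λ * ‖u - v‖ ^ 2 = Λ * (2 * (‖u‖ ^ 2 + ‖v‖ ^ 2)) := by
      linear_combination Λ * h3
    linarith
  rcases eq_or_ne x 0 with rfl | hx
  · simp
  rcases eq_or_ne y 0 with rfl | hy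
  · simp
  have hx' : 0 < ‖x‖ := norm_pos_iff.mpr hx
  have hy' : 0 < ‖y‖ := norm_pos_iff.mpr hy
  -- Rescaling to equal norms turns the sum of squares in `key` into a product.
  have h := key (‖y‖ • x) (‖x‖ • y)
  simp only [map_smul, LinearMap.smul_apply, norm_smul, norm_norm] at h
  refine le_of_mul_le_mul_left ?_ (mul_pos hx' hy')
  calc ‖x‖ * ‖y‖ * ‖B x y‖ = ‖x‖ * (‖y‖ * ‖B x y‖) := by ring
    _ ≤ _ := h
    _ = ‖x‖ * ‖y‖ * (Λ * ‖x‖ * ‖y‖) := by ring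

/-- Solvability, in the ball of radius `ρ`, of `D w + ½ B(w, w) = r` for small `r`. -/
theorem LinearMap.exists_add_half_quadratic_eq {E F : Type*}
    [NormedAddCommGroup E] [InnerProductSpace ℝ E] [FiniteDimensional ℝ E]
    [NormedAddCommGroup F] [InnerProductSpace ℝ F] [FiniteDimensional ℝ F]
    (B : E →ₗ[ℝ] E →ₗ[ℝ] F) (D : E →ₗ[ℝ] F) {Λ μ ρ : ℝ} (hΛ : 0 ≤ Λ) (hρ : 0 ≤ ρ)
    (hB : ∀ x y, B x y = B y x) (hbd : ∀ x y, ‖B x y‖ ≤ Λ * ‖x‖ * ‖y‖)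
    (hD : ∀ c, μ * ‖c‖ ≤ ‖LinearMap.adjoint D c‖) (hμρ : Λ * ρ < μ)
    {r : F} (hr : ‖r‖ + Λ * ρ ^ 2 / 2 ≤ μ * ρ) :
    ∃ w : E, ‖w‖ ≤ ρ ∧ D w + (1 / 2 : ℝ) • B w w = r := by
  have hμ : 0 < μ := (mul_nonneg hΛ hρ).trans_lt hμρ
  obtain ⟨R, hDR, hR⟩ := D.exists_rightInverse_of_adjoint_bound hμ hD
  -- A fixed point of `g` solves the equation, since `D ∘ R = id`.
  let g : E → E := fun w => R (r - (1 / 2 : ℝ) • B w w)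
  have hmaps : Set.MapsTo g (Metric.closedBall 0 ρ) (Metric.closedBall 0 ρ) := by
    intro w hw
    rw [mem_closedBall_zero_iff] at hw ⊢
    refine le_of_mul_le_mul_left ((hR _).trans (le_trans ?_ hr)) hμ
    refine (norm_sub_le _ _).trans ?_
    have h1 : ‖B w w‖ ≤ Λ * ρ ^ 2 := by
      calc ‖B w w‖ ≤ Λ * ‖w‖ * ‖w‖ := hbd w w
        _ ≤ Λ * ρ * ρ := by gcongr
        _ = Λ * ρ ^ 2 := by ring
    rw [norm_smul]
    norm_num
    linarith
  have hlip : ∀ w ∈ Metric.closedBall (0 : E) ρ, ∀ w' ∈ Metric.closedBall (0 : E) ρ,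
      dist (g w) (g w') ≤ Λ * ρ / μ * dist w w' := by
    intro w hw w' hw'
    rw [mem_closedBall_zero_iff] at hw hw'
    rw [dist_eq_norm, dist_eq_norm]
    have h1 : g w - g w' = R ((1 / 2 : ℝ) • B (w + w') (w' - w)) := by
      simp only [g]
      rw [← map_sub]
      congr 1
      simp only [map_add, map_sub, LinearMap.add_apply, hB w' w]
      module
    have h2 : ‖(1 / 2 : ℝ) • B (w + w') (w' - w)‖ ≤ Λ * ρ * ‖w - w'‖ := by
      rw [norm_smul]
      have h3 : ‖B (w + w') (w' - w)‖ ≤ Λ * (ρ + ρ) * ‖w' - w‖ := by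
        refine (hbd _ _).trans ?_
        gcongr
        exact (norm_add_le _ _).trans (add_le_add hw hw')
      rw [norm_sub_rev w' w] at h3
      rw [Real.norm_of_nonneg (by norm_num)]
      linarith
    rw [h1, div_mul_eq_mul_div, le_div_iff₀ hμ, mul_comm]
    exact (hR _).trans h2
  have hK : 0 ≤ Λ * ρ / μ := by positivity
  have hcontr : ContractingWith (Λ * ρ / μ).toNNReal (hmaps.restrict g _ _) := by
    refine ⟨?_, LipschitzWith.of_dist_le_mul ?_⟩
    · rw [Real.toNNReal_lt_one]
      exact (div_lt_one hμ).mpr hμρ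
    · rintro ⟨w, hw⟩ ⟨w', hw'⟩
      rw [Real.coe_toNNReal _ hK]
      exact hlip w hw w' hw'
  obtain ⟨w, hw, hfix, -⟩ := hcontr.exists_fixedPoint' (Metric.isClosed_closedBall.isComplete)
    hmaps (Metric.mem_closedBall_self hρ) (edist_ne_top _ _)
  refine ⟨w, mem_closedBall_zero_iff.mp hw, ?_⟩
  have h : D (g w) = r - (1 / 2 : ℝ) • B w w := hDR _
  rw [hfix.eq] at h
  rw [h, sub_add_cancel]

/-- The image of a ball of radius `ε` under `x ↦ ½ B(x, x) + T x` is convex when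
`2 Λ ε < ν`. -/
theorem LinearMap.convex_quadratic_image {E F : Type*}
    [NormedAddCommGroup E] [InnerProductSpace ℝ E] [FiniteDimensional ℝ E]
    [NormedAddCommGroup F] [InnerProductSpace ℝ F] [FiniteDimensional ℝ F]
    (B : E →ₗ[ℝ] E →ₗ[ℝ] F) (T : E →ₗ[ℝ] F) {Λ ν ε : ℝ} (hΛ : 0 ≤ Λ)
    (hB : ∀ x y, B x y = B y x) (hdiag : ∀ x, ‖B x x‖ ≤ Λ * ‖x‖ ^ 2)
    (hT : ∀ c, ν * ‖c‖ ≤ ‖LinearMap.adjoint T c‖) (hε : 2 * Λ * ε < ν) :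
    Convex ℝ ((fun x => (1 / 2 : ℝ) • B x x + T x) '' Metric.closedBall 0 ε) := by
  rcases lt_or_ge ε 0 with hneg | hε0
  · rw [Metric.closedBall_eq_empty.mpr hneg, Set.image_empty]
    exact convex_empty
  rcases hε0.eq_or_lt with rfl | hpos
  · simp
  have hbd := B.norm_le_of_symm_of_diag_bound hB hdiag
  rintro _ ⟨x₁, hx₁, rfl⟩ _ ⟨x₂, hx₂, rfl⟩ s t hs ht hst
  rw [mem_closedBall_zero_iff] at hx₁ hx₂
  set x₀ := s • x₁ + t • x₂ with hx₀
  -- `δ` is the strong convexity gain in `‖·‖²` at `x₀`.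
  set δ := s * t * ‖x₁ - x₂‖ ^ 2 with hδ
  have hδ0 : 0 ≤ δ := by positivity
  have hnorm : ‖x₀‖ ^ 2 ≤ ε ^ 2 - δ := by
    have h1 : ‖x₀‖ ^ 2 = s * ‖x₁‖ ^ 2 + t * ‖x₂‖ ^ 2 - δ := by
      rw [hx₀, hδ, norm_add_sq_real, norm_sub_sq_real, norm_smul, norm_smul, inner_smul_left,
        inner_smul_right, Real.norm_of_nonneg hs, Real.norm_of_nonneg ht]
      obtain rfl : t = 1 - s := by linarith
      simp
      ring
    have h2 : s * ‖x₁‖ ^ 2 ≤ s * ε ^ 2 := by gcongr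
    have h3 : t * ‖x₂‖ ^ 2 ≤ t * ε ^ 2 := by gcongr
    have h4 : s * ε ^ 2 + t * ε ^ 2 = ε ^ 2 := by rw [← add_mul, hst, one_mul]
    linarith
  -- Chosen so that `ε² - δ = ε² - 2ερ ≤ (ε - ρ)²`.
  set ρ := δ / (2 * ε) with hρ
  have hρ0 : 0 ≤ ρ := by positivity
  have hδρ : δ = 2 * ε * ρ := by rw [hρ]; field_simp
  have hx₀ρ : ‖x₀‖ + ρ ≤ ε := by
    have h1 : ρ ≤ ε := by
      by_contra! h
      nlinarith [sq_nonneg ‖x₀‖]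
    have h2 : ‖x₀‖ ≤ ε - ρ := by
      refine le_of_sq_le_sq ?_ (by linarith)
      nlinarith [sq_nonneg ρ]
    linarith
  -- Perturbing `T` by `B x₀` costs at most `Λ ‖x₀‖ ≤ Λ (ε - ρ)` in the lower bound.
  have hD : ∀ c, (ν - Λ * (ε - ρ)) * ‖c‖ ≤ ‖LinearMap.adjoint (T + B x₀) c‖ := by
    intro c
    have h1 : ‖LinearMap.adjoint (B x₀) c‖ ≤ Λ * (ε - ρ) * ‖c‖ := by
      set b := LinearMap.adjoint (B x₀) c with hb
      have h2 : ‖b‖ ^ 2 = inner ℝ c (B x₀ b) := by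
        rw [← LinearMap.adjoint_inner_left, real_inner_self_eq_norm_sq]
      have h3 : ‖b‖ * ‖b‖ ≤ (Λ * (ε - ρ) * ‖c‖) * ‖b‖ := by
        calc ‖b‖ * ‖b‖ = inner ℝ c (B x₀ b) := by rw [← h2, sq]
          _ ≤ ‖c‖ * ‖B x₀ b‖ := real_inner_le_norm _ _
          _ ≤ ‖c‖ * (Λ * ‖x₀‖ * ‖b‖) := by gcongr; exact hbd _ _
          _ ≤ ‖c‖ * (Λ * (ε - ρ) * ‖b‖) := by gcongr; linarith
          _ = _ := by ring
      rcases (norm_nonneg b).eq_or_lt with h0 | h0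
      · rw [← h0]
        have : 0 ≤ ε - ρ := by linarith [norm_nonneg x₀]
        positivity
      · exact le_of_mul_le_mul_right h3 h0
    have h4 : ‖LinearMap.adjoint T c‖ ≤
        ‖LinearMap.adjoint (T + B x₀) c‖ + ‖LinearMap.adjoint (B x₀) c‖ := by
      rw [map_add, LinearMap.add_apply]
      simpa using norm_sub_le (LinearMap.adjoint T c + LinearMap.adjoint (B x₀) c)
        (LinearMap.adjoint (B x₀) c)
    have h5 := hT c
    linarith
  have hΛε : 0 ≤ Λ * ε := by positivity
  obtain ⟨w, hw, hsol⟩ := B.exists_add_half_quadratic_eq (T + B x₀) (μ := ν - Λ * (ε - ρ))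
    (r := (s * t / 2) • B (x₁ - x₂) (x₁ - x₂)) hΛ hρ0 hB hbd hD (by linarith) (by
      have h1 : ‖(s * t / 2) • B (x₁ - x₂) (x₁ - x₂)‖ ≤ Λ * ε * ρ := by
        rw [norm_smul, Real.norm_of_nonneg (by positivity)]
        calc s * t / 2 * ‖B (x₁ - x₂) (x₁ - x₂)‖
            ≤ s * t / 2 * (Λ * ‖x₁ - x₂‖ ^ 2) := by gcongr; exact hdiag _
          _ = Λ * δ / 2 := by rw [hδ]; ring
          _ = Λ * ε * ρ := by rw [hδρ]; ring
      -- Exactly `2Λε ≤ ν` is needed here.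
      have h2 : (Λ * ε + Λ * ρ) * ρ ≤ (ν - Λ * (ε - ρ)) * ρ := by gcongr; linarith
      have h3 : 0 ≤ Λ * ρ ^ 2 := by positivity
      linarith)
  refine ⟨x₀ + w, ?_, ?_⟩
  · rw [mem_closedBall_zero_iff]
    exact (norm_add_le _ _).trans (by linarith)
  · have h1 : (1 / 2 : ℝ) • B (x₀ + w) (x₀ + w) + T (x₀ + w) =
        ((1 / 2 : ℝ) • B x₀ x₀ + T x₀) + ((T + B x₀) w + (1 / 2 : ℝ) • B w w) := by
      simp only [map_add, LinearMap.add_apply, hB w x₀]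
      module
    simp only
    rw [h1, hsol, hx₀]
    simp only [map_add, map_sub, map_smul, LinearMap.add_apply, LinearMap.sub_apply,
      LinearMap.smul_apply, hB x₂ x₁]
    obtain rfl : t = 1 - s := by linarith
    module

/-! ### Eigenvalue bounds and the matrix form of the map -/

namespace QuadraticImage

open scoped Matrix

variable {k n m : ℕ}

/-- A Rayleigh quotient of a symmetric matrix is at most the largest eigenvalue. -/
theorem dotProduct_mulVec_le_lambdaMax {M : Matrix (Fin k) (Fin k) ℝ} (hM : M.IsHermitian)
    (x : Fin k → ℝ) : x ⬝ᵥ (M *ᵥ x) ≤ lambdaMax M * (x ⬝ᵥ x) := by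
  have hpsd : (algebraMap ℝ (Matrix (Fin k) (Fin k) ℝ) (lambdaMax M) - M).PosSemidef := by
    rw [Matrix.posSemidef_iff_isHermitian_and_spectrum_nonneg]
    refine ⟨?_, ?_⟩
    · exact (Matrix.isHermitian_diagonal _).sub hM
    · rw [← spectrum.singleton_sub_eq]
      rintro _ ⟨_, rfl, μ, hμ, rfl⟩
      exact sub_nonneg.mpr (le_csSup Matrix.finite_real_spectrum.bddAbove hμ)
  have h := hpsd.dotProduct_mulVec_nonneg x
  simp only [star_trivial, Matrix.sub_mulVec, Algebra.algebraMap_eq_smul_one, Matrix.smul_mulVec,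
    Matrix.one_mulVec, dotProduct_sub, dotProduct_smul, smul_eq_mul] at h
  linarith

/-- A Rayleigh quotient of a symmetric matrix is at least the smallest eigenvalue. -/
theorem lambdaMin_le_dotProduct_mulVec {M : Matrix (Fin k) (Fin k) ℝ} (hM : M.IsHermitian)
    (x : Fin k → ℝ) : lambdaMin M * (x ⬝ᵥ x) ≤ x ⬝ᵥ (M *ᵥ x) := by
  have hpsd : (M - algebraMap ℝ (Matrix (Fin k) (Fin k) ℝ) (lambdaMin M)).PosSemidef := by
    rw [Matrix.posSemidef_iff_isHermitian_and_spectrum_nonneg]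
    refine ⟨?_, ?_⟩
    · exact hM.sub (Matrix.isHermitian_diagonal _)
    · rw [← spectrum.sub_singleton_eq]
      rintro _ ⟨μ, hμ, _, rfl, rfl⟩
      exact sub_nonneg.mpr (csInf_le Matrix.finite_real_spectrum.bddBelow hμ)
  have h := hpsd.dotProduct_mulVec_nonneg x
  simp only [star_trivial, Matrix.sub_mulVec, Algebra.algebraMap_eq_smul_one, Matrix.smul_mulVec,
    Matrix.one_mulVec, dotProduct_sub, dotProduct_smul, smul_eq_mul] at h
  linarith

theorem dotProduct_self_eq_norm_sq (x : EuclideanSpace ℝ (Fin k)) :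
    x.ofLp ⬝ᵥ x.ofLp = ‖x‖ ^ 2 := by
  rw [EuclideanSpace.real_norm_sq_eq]
  simp [dotProduct, sq]

theorem dotProduct_transpose_mul_self (M : Matrix (Fin n) (Fin k) ℝ) (x : Fin k → ℝ) :
    x ⬝ᵥ ((Mᵀ * M) *ᵥ x) = (M *ᵥ x) ⬝ᵥ (M *ᵥ x) := by
  rw [← Matrix.mulVec_mulVec, Matrix.dotProduct_mulVec, Matrix.vecMul_transpose]

theorem posSemidef_transpose_mul_self (M : Matrix (Fin n) (Fin k) ℝ) : (Mᵀ * M).PosSemidef := by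
  simpa using Matrix.posSemidef_conjTranspose_mul_self M

theorem posSemidef_sum_transpose_mul_self (A : Fin m → Matrix (Fin n) (Fin n) ℝ) :
    (∑ i, (A i)ᵀ * A i).PosSemidef :=
  Matrix.posSemidef_sum _ fun i _ => posSemidef_transpose_mul_self (A i)

theorem spectrum_nonneg {M : Matrix (Fin k) (Fin k) ℝ} (hM : M.PosSemidef) {μ : ℝ}
    (hμ : μ ∈ spectrum ℝ M) : 0 ≤ μ :=
  (Matrix.posSemidef_iff_isHermitian_and_spectrum_nonneg.mp hM).2 hμ

theorem lambdaMax_nonneg {M : Matrix (Fin k) (Fin k) ℝ} (hM : M.PosSemidef) : 0 ≤ lambdaMax M :=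
  Real.sSup_nonneg fun _ => spectrum_nonneg hM

theorem lambdaMin_nonneg {M : Matrix (Fin k) (Fin k) ℝ} (hM : M.PosSemidef) : 0 ≤ lambdaMin M :=
  Real.sInf_nonneg fun _ => spectrum_nonneg hM

theorem sum_norm_sq_mulVec_le (A : Fin m → Matrix (Fin n) (Fin n) ℝ)
    (x : EuclideanSpace ℝ (Fin n)) :
    ∑ i, ‖WithLp.toLp 2 (A i *ᵥ x.ofLp)‖ ^ 2 ≤ Lnew A ^ 2 * ‖x‖ ^ 2 := by
  have hpsd := posSemidef_sum_transpose_mul_self A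
  have h := dotProduct_mulVec_le_lambdaMax hpsd.1 x.ofLp
  rw [Matrix.sum_mulVec, dotProduct_sum, dotProduct_self_eq_norm_sq] at h
  rw [Lnew, Real.sq_sqrt (lambdaMax_nonneg hpsd)]
  refine le_of_eq_of_le (Finset.sum_congr rfl fun i _ => ?_) h
  rw [dotProduct_transpose_mul_self, ← dotProduct_self_eq_norm_sq]

open scoped Matrix.Norms.L2Operator in
theorem Lnew_le_L (A : Fin m → Matrix (Fin n) (Fin n) ℝ) : Lnew A ≤ L A := by
  refine Real.sqrt_le_sqrt (Real.sSup_le (fun μ hμ => ?_) (by positivity))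
  -- For `n = 0` the matrix ring is trivial and spectra are empty.
  rcases isEmpty_or_nonempty (Fin n) with h | h
  · rw [spectrum.of_subsingleton] at hμ
    exact hμ.elim
  calc μ ≤ ‖μ‖ := Real.le_norm_self μ
    _ ≤ ‖∑ i, (A i)ᵀ * A i‖ := spectrum.norm_le_norm_of_mem hμ
    _ ≤ ∑ i, ‖(A i)ᵀ * A i‖ := norm_sum_le _ _
    _ = ∑ i, ‖A i‖ ^ 2 := Finset.sum_congr rfl fun i _ => by
      rw [← Matrix.conjTranspose_eq_transpose_of_trivial, Matrix.l2_opNorm_conjTranspose_mul_self,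
        sq]

/-- The polarization of the quadratic part of `quadMap`. -/
noncomputable def polar (A : Fin m → Matrix (Fin n) (Fin n) ℝ) :
    EuclideanSpace ℝ (Fin n) →ₗ[ℝ] EuclideanSpace ℝ (Fin n) →ₗ[ℝ] EuclideanSpace ℝ (Fin m) :=
  LinearMap.mk₂ ℝ
    (fun x y => WithLp.toLp 2 fun i =>
      -- Averaged because the `A i` need not be symmetric.
      (1 / 2 : ℝ) * (x.ofLp ⬝ᵥ (A i *ᵥ y.ofLp) + y.ofLp ⬝ᵥ (A i *ᵥ x.ofLp)))
    (fun x x' y => by ext i; simp [Matrix.mulVec_add]; ring)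
    (fun c x y => by ext i; simp [Matrix.mulVec_smul]; ring)
    (fun x y y' => by ext i; simp [Matrix.mulVec_add]; ring)
    (fun c x y => by ext i; simp [Matrix.mulVec_smul]; ring)

theorem polar_symm (A : Fin m → Matrix (Fin n) (Fin n) ℝ) (x y : EuclideanSpace ℝ (Fin n)) :
    polar A x y = polar A y x := by
  ext i
  simp [polar, add_comm]

theorem polar_self_apply (A : Fin m → Matrix (Fin n) (Fin n) ℝ) (x : EuclideanSpace ℝ (Fin n))
    (i : Fin m) : polar A x x i = x.ofLp ⬝ᵥ (A i *ᵥ x.ofLp) := by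
  simp [polar]
  ring

theorem norm_polar_self_le (A : Fin m → Matrix (Fin n) (Fin n) ℝ)
    (x : EuclideanSpace ℝ (Fin n)) : ‖polar A x x‖ ≤ Lnew A * ‖x‖ ^ 2 := by
  have hL : 0 ≤ Lnew A := Real.sqrt_nonneg _
  refine le_of_sq_le_sq ?_ (by positivity)
  rw [EuclideanSpace.real_norm_sq_eq]
  calc ∑ i, polar A x x i ^ 2
      ≤ ∑ i, ‖x‖ ^ 2 * ‖WithLp.toLp 2 (A i *ᵥ x.ofLp)‖ ^ 2 := by
        refine Finset.sum_le_sum fun i _ => ?_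
        have h := abs_real_inner_le_norm (WithLp.toLp 2 (A i *ᵥ x.ofLp)) x
        rw [EuclideanSpace.inner_eq_star_dotProduct] at h
        rw [polar_self_apply, ← mul_pow, ← sq_abs, mul_comm ‖x‖]
        simp only [star_trivial] at h
        gcongr
    _ ≤ ‖x‖ ^ 2 * (Lnew A ^ 2 * ‖x‖ ^ 2) := by
        rw [← Finset.mul_sum]
        gcongr
        exact sum_norm_sq_mulVec_le A x
    _ = (Lnew A * ‖x‖ ^ 2) ^ 2 := by ring

/-- The linear part of `quadMap`. -/
noncomputable def linPart (a : Fin m → EuclideanSpace ℝ (Fin n)) :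
    EuclideanSpace ℝ (Fin n) →ₗ[ℝ] EuclideanSpace ℝ (Fin m) :=
  Matrix.toEuclideanLin (colMatrix a)ᵀ

theorem linPart_apply (a : Fin m → EuclideanSpace ℝ (Fin n)) (x : EuclideanSpace ℝ (Fin n))
    (i : Fin m) : linPart a x i = (a i).ofLp ⬝ᵥ x.ofLp := rfl

theorem nu_mul_norm_le (a : Fin m → EuclideanSpace ℝ (Fin n)) (c : EuclideanSpace ℝ (Fin m)) :
    nu a * ‖c‖ ≤ ‖LinearMap.adjoint (linPart a) c‖ := by
  have hadj : LinearMap.adjoint (linPart a) = Matrix.toEuclideanLin (colMatrix a) := by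
    rw [linPart, ← Matrix.conjTranspose_eq_transpose_of_trivial,
      Matrix.toEuclideanLin_conjTranspose_eq_adjoint, LinearMap.adjoint_adjoint]
  have hpsd := posSemidef_transpose_mul_self (colMatrix a)
  have h := lambdaMin_le_dotProduct_mulVec hpsd.1 c.ofLp
  rw [dotProduct_transpose_mul_self, dotProduct_self_eq_norm_sq] at h
  refine le_of_sq_le_sq ?_ (norm_nonneg _)
  rw [mul_pow, nu, Real.sq_sqrt (lambdaMin_nonneg hpsd), hadj,
    ← dotProduct_self_eq_norm_sq (Matrix.toEuclideanLin (colMatrix a) c)]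
  exact h

theorem quadMap_eq (A : Fin m → Matrix (Fin n) (Fin n) ℝ) (a : Fin m → EuclideanSpace ℝ (Fin n))
    (x : EuclideanSpace ℝ (Fin n)) :
    quadMap A a x = (1 / 2 : ℝ) • polar A x x + linPart a x := by
  ext i
  simp only [quadMap, PiLp.add_apply, PiLp.smul_apply, smul_eq_mul, polar_self_apply,
    linPart_apply]

theorem ballImage_eq (A : Fin m → Matrix (Fin n) (Fin n) ℝ)
    (a : Fin m → EuclideanSpace ℝ (Fin n)) (ε : ℝ) :
    ballImage A a ε =
      (fun x => (1 / 2 : ℝ) • polar A x x + linPart a x) '' Metric.closedBall 0 ε := by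
  ext y
  simp [ballImage, quadMap_eq]

end QuadraticImage

/-- When `Lnew A = 0` the threshold `ν / (2 L_new)` is read as `+∞`. -/
theorem theorem2 {n m : ℕ} (A : Fin m → Matrix (Fin n) (Fin n) ℝ)
    (a : Fin m → EuclideanSpace ℝ (Fin n)) :
    QuadraticImage.Lnew A ≤ QuadraticImage.L A ∧
      ∀ ε : ℝ,
        (QuadraticImage.Lnew A = 0 ∨
          ε < QuadraticImage.nu a / (2 * QuadraticImage.Lnew A)) →
        Convex ℝ (QuadraticImage.ballImage A a ε) := by
  refine ⟨QuadraticImage.Lnew_le_L A, fun ε hε => ?_⟩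
  rw [QuadraticImage.ballImage_eq]
  have hdiag := QuadraticImage.norm_polar_self_le A
  rcases eq_or_ne (QuadraticImage.Lnew A) 0 with h0 | h0
  -- Here the map is linear, so every `ε` works.
  · have hzero : ∀ x, QuadraticImage.polar A x x = 0 := fun x => by
      simpa [h0] using hdiag x
    simp only [hzero, smul_zero, zero_add]
    exact (convex_closedBall 0 ε).linear_image _
  · have hpos : 0 < QuadraticImage.Lnew A := (Real.sqrt_nonneg _).lt_of_ne' h0
    have hlt := (lt_div_iff₀ (by positivity)).mp (hε.resolve_left h0)
    exact LinearMap.convex_quadratic_image _ _ hpos.le (QuadraticImage.polar_symm A) hdiag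
      (QuadraticImage.nu_mul_norm_le a) (by linarith)
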